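/- Let $X$ be a real or complex Banach space and let $A : D(A) \subset X \to X$ be a densely defined linear operator. Let $\rho(A)$ be its resolvent set, i.e. the set of scalars $\lambda$ for which $\lambda I - A : D(A) \to X$ is bijective with bounded inverse, and for $\tau > 0$ with $1/\tau \in \rho(A)$ let $$V_\tau := (\tau A + I)(\tau A - I)^{-1},$$ which is a bounded linear operator on $X$. Then the following assertions are equivalent. (i) $A$ is the generator of a contraction $C_0$-semigroup on $X$, i.e. of a strongly continuous semigroup $(T(t))_{t \ge 0}$ with $\|T(t)\| \le 1$ for all $t \ge 0$. (ii) $(0,\infty) \subset \rho(A)$ and $\|V_\tau - I\| \le 2$ for all $\tau > 0$. (iii) There exists $\tau_0 > 0$ such that $(1/\tau_0, \infty) \subset \rho(A)$ and $\|V_\tau - I\| \le 2$ for all $0 < \tau < \tau_0$. -/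

import Mathlib

open Filter Topology
open scoped NNReal

/-- A strongly continuous semigroup `(T(t))_{t ≥ 0}` of bounded linear operators on `X`. -/
structure C0Semigroup (𝕜 X : Type*) [RCLike 𝕜] [NormedAddCommGroup X] [NormedSpace 𝕜 X] where
  toFun : ℝ≥0 → X →L[𝕜] X
  map_zero : toFun 0 = 1
  map_add : ∀ s t : ℝ≥0, toFun (s + t) = toFun s * toFun t
  continuous_orbit : ∀ x : X, Continuous fun t : ℝ≥0 => toFun t x

section

variable {𝕜 X : Type*} [RCLike 𝕜] [NormedAddCommGroup X] [NormedSpace 𝕜 X]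

/-- `A` is the generator of `T`: the graph of `A` consists of exactly those pairs `(x, y)` for
which `(T(t) x - x) / t → y` as `t → 0+`.  In particular the domain of `A` is the set of all `x`
for which this limit exists. -/
def C0Semigroup.IsGenerator (T : C0Semigroup 𝕜 X) (A : X →ₗ.[𝕜] X) : Prop :=
  ∀ x y : X, (x, y) ∈ A.graph ↔
    Tendsto (fun t : ℝ≥0 => ((t : ℝ) : 𝕜)⁻¹ • (T.toFun t x - x)) (𝓝[>] 0) (𝓝 y)

/-- `A` generates a contraction `C₀`-semigroup. -/
def GeneratesContractionSemigroup (A : X →ₗ.[𝕜] X) : Prop :=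
  ∃ T : C0Semigroup 𝕜 X, (∀ t : ℝ≥0, ‖T.toFun t‖ ≤ 1) ∧ T.IsGenerator A

namespace UnboundedOperator

/-- The operator `a A + b I : D(A) → X`. -/
def affine (A : X →ₗ.[𝕜] X) (a b : 𝕜) : A.domain →ₗ[𝕜] X :=
  a • A.toFun + b • A.domain.subtype

/-- The resolvent set `ρ(A)` of an unbounded operator `A`: all scalars `z` such that
`z I - A : D(A) → X` is bijective with bounded inverse
(`D(A)` carries the norm of `X`, not the graph norm). -/
def resolventSet (A : X →ₗ.[𝕜] X) : Set 𝕜 :=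
  {z | ∃ R : X →L[𝕜] A.domain,
    Function.LeftInverse R (affine A (-1) z) ∧ Function.RightInverse R (affine A (-1) z)}

theorem affine_eq (A : X →ₗ.[𝕜] X) {τ : ℝ} (hτ : 0 < τ) (x : A.domain) :
    affine A (τ : 𝕜) (-1) x = (-τ : 𝕜) • affine A (-1) ((τ⁻¹ : ℝ) : 𝕜) x := by
  have h : (τ : 𝕜) ≠ 0 := by exact_mod_cast hτ.ne'
  simp [affine, smul_smul, h]

/-- If `1/τ ∈ ρ(A)` then `τ A - I : D(A) → X` is bijective. -/
theorem bijective_affine (A : X →ₗ.[𝕜] X) {τ : ℝ} (hτ : 0 < τ)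
    (h : ((τ⁻¹ : ℝ) : 𝕜) ∈ resolventSet A) :
    Function.Bijective (affine A (τ : 𝕜) (-1)) := by
  obtain ⟨R, hl, hr⟩ := h
  have h0 : (-τ : 𝕜) ≠ 0 := neg_ne_zero.mpr (by exact_mod_cast hτ.ne')
  constructor
  · intro x y hxy
    rw [affine_eq A hτ, affine_eq A hτ] at hxy
    exact hl.injective (smul_right_injective X h0 hxy)
  · intro y
    refine ⟨R ((-τ : 𝕜)⁻¹ • y), ?_⟩
    rw [affine_eq A hτ, hr, smul_smul, mul_inv_cancel₀ h0, one_smul]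

/-- `V_τ = (τ A + I) (τ A - I)⁻¹` as a linear map on `X`. -/
noncomputable def cayleyLinear (A : X →ₗ.[𝕜] X) {τ : ℝ} (hτ : 0 < τ)
    (h : ((τ⁻¹ : ℝ) : 𝕜) ∈ resolventSet A) : X →ₗ[𝕜] X :=
  affine A (τ : 𝕜) 1 ∘ₗ (LinearEquiv.ofBijective _ (bijective_affine A hτ h)).symm.toLinearMap

theorem continuous_cayleyLinear (A : X →ₗ.[𝕜] X) {τ : ℝ} (hτ : 0 < τ)
    (h : ((τ⁻¹ : ℝ) : 𝕜) ∈ resolventSet A) : Continuous (cayleyLinear A hτ h) := by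
  obtain ⟨R, hl, hr⟩ := id h
  have h0 : (-τ : 𝕜) ≠ 0 := neg_ne_zero.mpr (by exact_mod_cast hτ.ne')
  have key : ∀ y, cayleyLinear A hτ h y = y + (2 : 𝕜) • (R ((-τ : 𝕜)⁻¹ • y) : X) := by
    intro y
    obtain ⟨x, rfl⟩ := (bijective_affine A hτ h).2 y
    have hx : R ((-τ : 𝕜)⁻¹ • affine A (τ : 𝕜) (-1) x) = x := by
      rw [affine_eq A hτ, smul_smul, inv_mul_cancel₀ h0, one_smul, hl]
    have hs : (LinearEquiv.ofBijective _ (bijective_affine A hτ h)).symm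
        (affine A (τ : 𝕜) (-1) x) = x :=
      (LinearEquiv.ofBijective _ (bijective_affine A hτ h)).symm_apply_apply x
    rw [hx]
    simp only [cayleyLinear, LinearMap.comp_apply, LinearEquiv.coe_coe, hs]
    simp only [affine, LinearMap.add_apply, LinearMap.smul_apply, Submodule.subtype_apply]
    module
  rw [show (cayleyLinear A hτ h : X → X) = _ from funext key]
  fun_prop

/-- The bounded operator `V_τ = (τ A + I) (τ A - I)⁻¹` on `X`, for `τ > 0` with `1/τ ∈ ρ(A)`. -/
noncomputable def cayley (A : X →ₗ.[𝕜] X) {τ : ℝ} (hτ : 0 < τ)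
    (h : ((τ⁻¹ : ℝ) : 𝕜) ∈ resolventSet A) : X →L[𝕜] X :=
  ⟨cayleyLinear A hτ h, continuous_cayleyLinear A hτ h⟩

end UnboundedOperator

end

/-! Since `(τA + I) - (τA - I) = 2I`, one has `V_τ - I = 2 (τA - I)⁻¹ = -(2/τ) (1/τ - A)⁻¹`. Hence
`‖V_τ - I‖ ≤ 2` says exactly `‖(λ - A)⁻¹‖ ≤ 1/λ` with `λ = 1/τ` (`norm_cayley_sub_one_le_iff`), and
the theorem becomes the Hille–Yosida theorem for contractions. Necessity: the Laplace transform of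
the semigroup inverts `λ - A` and has norm at most `1/λ` (`exists_isResolvent_of_isGenerator`).
Sufficiency needs the resolvent bound only along one sequence `a n → ∞`. The Yosida approximations
are bounded, commute, generate contractions and converge to `A` on `D(A)`; their exponentials
converge to a contraction semigroup (`exists_contractionSemigroup_of_tendsto`). Its generator
extends `A`, and equals `A` because a resolvent value of `A` exists at a point where the generator
minus that scalar is injective. -/

/-! ### Exponentials of bounded operators. -/

section ExpOperator

open NormedSpace

variable {𝕜 X : Type*} [RCLike 𝕜] [NormedAddCommGroup X] [NormedSpace 𝕜 X]

/-- `B` generates a contraction semigroup `exp (t B)`. -/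
def ContinuousLinearMap.IsExpContractive (B : X →L[𝕜] X) : Prop :=
  ∀ t : ℝ, 0 ≤ t → ‖exp ((t : 𝕜) • B)‖ ≤ 1

theorem ContinuousLinearMap.IsExpContractive.norm_apply_le {B : X →L[𝕜] X}
    (hB : B.IsExpContractive) {t : ℝ} (ht : 0 ≤ t) (x : X) : ‖exp ((t : 𝕜) • B) x‖ ≤ ‖x‖ := by
  simpa using ContinuousLinearMap.le_of_opNorm_le _ (hB t ht) x

variable [CompleteSpace X]

theorem ContinuousLinearMap.exp_add_of_commute {B C : X →L[𝕜] X} (h : Commute B C) :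
    exp (B + C) = exp B * exp C :=
  NormedSpace.exp_add_of_commute_of_mem_ball (𝕂 := 𝕜) h
    ((expSeries_radius_eq_top 𝕜 (X →L[𝕜] X)).symm ▸ edist_lt_top _ _)
    ((expSeries_radius_eq_top 𝕜 (X →L[𝕜] X)).symm ▸ edist_lt_top _ _)

theorem ContinuousLinearMap.norm_exp_le (B : X →L[𝕜] X) : ‖exp B‖ ≤ Real.exp ‖B‖ := by
  have h1 := exp_series_hasSum_exp' (𝕂 := 𝕜) B
  have h2 := exp_series_hasSum_exp' (𝕂 := ℝ) ‖B‖
  rw [← Real.exp_eq_exp_ℝ] at h2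
  refine h1.norm_le_of_bounded h2 fun n => ?_
  have h3 : ‖B ^ n‖ ≤ ‖B‖ ^ n := by
    -- `X` may be trivial, so only `‖1‖ ≤ 1` holds and the zeroth power is treated apart.
    rcases Nat.eq_zero_or_pos n with rfl | hn
    · simpa using! ContinuousLinearMap.norm_id_le (𝕜 := 𝕜) (E := X)
    · exact norm_pow_le' B hn
  rw [norm_smul, norm_inv, RCLike.norm_natCast, smul_eq_mul]
  gcongr

/-- The exponential of `C - c I` is a contraction if `‖C‖ ≤ c`. -/
theorem ContinuousLinearMap.norm_exp_sub_smul_one_le (C : X →L[𝕜] X) {c : ℝ} (h : ‖C‖ ≤ c) :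
    ‖exp (C - (c : 𝕜) • (1 : X →L[𝕜] X))‖ ≤ 1 := by
  have hcomm : Commute C (-((c : 𝕜) • (1 : X →L[𝕜] X))) :=
    ((Commute.one_right C).smul_right _).neg_right
  have h1 : exp (-((c : 𝕜) • (1 : X →L[𝕜] X))) = ((Real.exp (-c) : ℝ) : 𝕜) • 1 := by
    have h2 := algebraMap_exp_comm (𝔸 := X →L[𝕜] X) ((-c : ℝ) : 𝕜)
    have h3 := algebraMap_exp_comm (𝔸 := 𝕜) (-c : ℝ)
    rw [RCLike.algebraMap_eq_ofReal] at h3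
    rw [← h3, Algebra.algebraMap_eq_smul_one, Algebra.algebraMap_eq_smul_one,
      ← Real.exp_eq_exp_ℝ] at h2
    rw [h2]
    simp
  rw [sub_eq_add_neg, ContinuousLinearMap.exp_add_of_commute hcomm, h1, mul_smul_comm, mul_one,
    norm_smul, RCLike.norm_ofReal, abs_of_pos (Real.exp_pos _)]
  calc Real.exp (-c) * ‖exp C‖ ≤ Real.exp (-c) * Real.exp c := by
        gcongr
        exact (ContinuousLinearMap.norm_exp_le C).trans (Real.exp_le_exp.2 h)
    _ = 1 := by rw [← Real.exp_add]; simp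

variable [NormedSpace ℝ X] [IsScalarTower ℝ 𝕜 X]

theorem ContinuousLinearMap.hasDerivAt_exp_ofReal_smul_apply (B : X →L[𝕜] X) (x : X) (t : ℝ) :
    HasDerivAt (fun s : ℝ => exp ((s : 𝕜) • B) x) (exp ((t : 𝕜) • B) (B x)) t := by
  have h1 : HasDerivAt (fun u : 𝕜 => exp (u • B) x) (exp ((t : 𝕜) • B) (B x)) (t : 𝕜) :=
    (hasDerivAt_exp_smul_const B (t : 𝕜)).clm_apply (hasDerivAt_const _ x) |>.congr_deriv (by simp)
  have h2 : HasDerivAt (fun s : ℝ => (s : 𝕜)) 1 t := by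
    simpa using (RCLike.ofRealCLM (K := 𝕜)).hasDerivAt (x := t)
  exact (h1.scomp t h2).congr_deriv (one_smul _ _)

/-- The path `s ↦ exp (s(B - C)) exp (tC) x` joins the two vectors. By commutativity its derivative
is `exp (sB) exp ((t - s)C) (B - C) x`, and both exponentials are contractions for `0 ≤ s ≤ t`. -/
theorem ContinuousLinearMap.IsExpContractive.norm_exp_sub_le {B C : X →L[𝕜] X}
    (hB : B.IsExpContractive) (hC : C.IsExpContractive) (h : Commute B C) {t : ℝ} (ht : 0 ≤ t)
    (x : X) : ‖exp ((t : 𝕜) • B) x - exp ((t : 𝕜) • C) x‖ ≤ t * ‖B x - C x‖ := by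
  have hsplit : ∀ s : ℝ, exp ((s : 𝕜) • (B - C)) * exp ((t : 𝕜) • C) =
      exp ((s : 𝕜) • B) * exp (((t - s : ℝ) : 𝕜) • C) := by
    intro s
    have hc : Commute (B - C) C := h.sub_left (Commute.refl C)
    rw [← ContinuousLinearMap.exp_add_of_commute ((hc.smul_left _).smul_right _),
      ← ContinuousLinearMap.exp_add_of_commute ((h.smul_left _).smul_right _)]
    congr 1
    push_cast
    module
  have hcomm : ∀ y, (B - C) (exp ((t : 𝕜) • C) y) = exp ((t : 𝕜) • C) ((B - C) y) := by
    intro y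
    have hc : Commute (B - C) ((t : 𝕜) • C) := (h.sub_left (Commute.refl C)).smul_right _
    exact DFunLike.congr_fun hc.exp_right.eq y
  have key := norm_image_sub_le_of_norm_deriv_le_segment' (a := 0) (b := t) (C := ‖B x - C x‖)
    (f := fun s : ℝ => exp ((s : 𝕜) • (B - C)) (exp ((t : 𝕜) • C) x))
    (fun s _ => ((B - C).hasDerivAt_exp_ofReal_smul_apply _ s).hasDerivWithinAt)
    (fun s hs => by
      rw [hcomm, ← mul_apply_eq_comp, hsplit, mul_apply_eq_comp]
      refine (hB.norm_apply_le hs.1 _).trans ?_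
      exact hC.norm_apply_le (sub_nonneg.2 hs.2.le) _) t ⟨ht, le_rfl⟩
  have h0 := hsplit t
  simp only [sub_self, RCLike.ofReal_zero, zero_smul, exp_zero, mul_one] at h0
  have h1 := DFunLike.congr_fun h0 x
  rw [mul_apply_eq_comp] at h1
  rw [h1] at key
  simpa [mul_comm] using key

theorem ContinuousLinearMap.IsExpContractive.norm_exp_sub_self_le {B : X →L[𝕜] X}
    (hB : B.IsExpContractive) {t : ℝ} (ht : 0 ≤ t) (x : X) :
    ‖exp ((t : 𝕜) • B) x - x‖ ≤ t * ‖B x‖ := by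
  have key := norm_image_sub_le_of_norm_deriv_le_segment' (a := 0) (b := t) (C := ‖B x‖)
    (f := fun s : ℝ => exp ((s : 𝕜) • B) x)
    (fun s _ => (B.hasDerivAt_exp_ofReal_smul_apply _ s).hasDerivWithinAt)
    (fun s hs => hB.norm_apply_le hs.1 _) t ⟨ht, le_rfl⟩
  simpa [mul_comm] using key

/-- First order Taylor estimate for `exp (t B) x`, where `B x` is approximated by `z`. -/
theorem ContinuousLinearMap.IsExpContractive.norm_exp_sub_self_sub_smul_le {B : X →L[𝕜] X}
    (hB : B.IsExpContractive) {t : ℝ} (ht : 0 ≤ t) (x z : X) :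
    ‖exp ((t : 𝕜) • B) x - x - (t : 𝕜) • B x‖ ≤ t * (2 * ‖B x - z‖ + t * ‖B z‖) := by
  have key := norm_image_sub_le_of_norm_deriv_le_segment' (a := 0) (b := t)
    (C := 2 * ‖B x - z‖ + t * ‖B z‖)
    (f := fun s : ℝ => exp ((s : 𝕜) • B) x - s • B x)
    (fun s _ => ((B.hasDerivAt_exp_ofReal_smul_apply x s).sub
      ((hasDerivAt_id s).smul_const (B x))).hasDerivWithinAt)
    (fun s hs => by
      -- Passing through `z` avoids `B (B x)`, which need not stay bounded when `B` runs through
      -- approximations of an unbounded operator.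
      have e : exp ((s : 𝕜) • B) (B x) - (1 : ℝ) • B x =
          exp ((s : 𝕜) • B) (B x - z) + (exp ((s : 𝕜) • B) z - z) - (B x - z) := by
        rw [map_sub, one_smul]; abel
      rw [e]
      have h1 := hB.norm_apply_le hs.1 (B x - z)
      have h2 := hB.norm_exp_sub_self_le hs.1 z
      have h3 : s * ‖B z‖ ≤ t * ‖B z‖ := by gcongr; exact hs.2.le
      refine (norm_sub_le _ _).trans ?_
      have h4 := norm_add_le (exp ((s : 𝕜) • B) (B x - z)) (exp ((s : 𝕜) • B) z - z)
      linarith) t ⟨ht, le_rfl⟩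
  have e : (t : 𝕜) • B x = t • B x := by
    rw [← RCLike.real_smul_eq_coe_smul (K := 𝕜)]
  rw [e]
  simp only [RCLike.ofReal_zero, zero_smul, exp_zero, one_apply_eq_self, sub_zero] at key
  rw [sub_right_comm, mul_comm]
  exact key

end ExpOperator

/-! ### Strong limits of contraction semigroups. -/

section LimitSemigroup

open NormedSpace

variable {𝕜 X : Type*} [RCLike 𝕜] [NormedAddCommGroup X] [NormedSpace 𝕜 X]

/-- Strong continuity of a contraction semigroup only has to be checked on a dense set. -/
theorem continuous_orbit_of_dense {S : ℝ≥0 → X →L[𝕜] X} (hadd : ∀ s t, S (s + t) = S s * S t)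
    (hS : ∀ t, ‖S t‖ ≤ 1) {D : Set X} (hD : Dense D)
    (hlip : ∀ z ∈ D, ∃ C : ℝ≥0, ∀ t, ‖S t z - z‖ ≤ C * t) (x : X) :
    Continuous fun t => S t x := by
  have hle : ∀ t y, ‖S t y‖ ≤ ‖y‖ := fun t y => by
    simpa using ContinuousLinearMap.le_of_opNorm_le _ (hS t) y
  -- Contractivity makes the orbit of a nearby `z ∈ D` uniformly close to that of `x`, and the orbit
  -- of `z` is Lipschitz.
  refine continuous_of_uniform_approx_of_continuous fun u hu => ?_
  obtain ⟨ε, hε, hu⟩ := Metric.mem_uniformity_dist.1 hu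
  obtain ⟨z, hz, hxz⟩ := hD.exists_dist_lt x hε
  obtain ⟨C, hC⟩ := hlip z hz
  refine ⟨fun t => S t z, ?_, fun t => hu ?_⟩
  · refine LipschitzWith.continuous (K := C) (LipschitzWith.of_dist_le_mul fun s t => ?_)
    wlog hst : s ≤ t generalizing s t
    · rw [dist_comm, dist_comm s]
      exact this t s (le_of_not_ge hst)
    have e : S t z - S s z = S s (S (t - s) z - z) := by
      rw [map_sub, ← mul_apply_eq_comp, ← hadd, add_tsub_cancel_of_le hst]
    rw [dist_comm, dist_eq_norm, e, dist_comm, NNReal.dist_eq,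
      abs_of_nonneg (sub_nonneg.2 (NNReal.coe_le_coe.2 hst)), ← NNReal.coe_sub hst]
    exact (hle _ _).trans (hC _)
  · rw [dist_eq_norm, ← map_sub]
    exact (hle _ _).trans_lt (by rwa [← dist_eq_norm])

variable [CompleteSpace X] [NormedSpace ℝ X] [IsScalarTower ℝ 𝕜 X]

/-- On `D` the sequence is Cauchy by `norm_exp_sub_le`; contractivity carries this over to all `x`
by density. -/
theorem exists_tendsto_exp_apply {B : ℕ → X →L[𝕜] X} (hB : ∀ n, (B n).IsExpContractive)
    (hcomm : ∀ m n, Commute (B m) (B n)) {D : Set X} (hD : Dense D)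
    (hlim : ∀ z ∈ D, ∃ y, Tendsto (fun n => B n z) atTop (𝓝 y)) {t : ℝ} (ht : 0 ≤ t) (x : X) :
    ∃ y, Tendsto (fun n => exp ((t : 𝕜) • B n) x) atTop (𝓝 y) := by
  refine cauchySeq_tendsto_of_complete (Metric.cauchySeq_iff.2 fun ε hε => ?_)
  obtain ⟨z, hz, hxz⟩ := hD.exists_dist_lt x (show 0 < ε / 4 by positivity)
  obtain ⟨y, hy⟩ := hlim z hz
  -- The denominator has `t + 1` rather than `t` to allow `t = 0`.
  obtain ⟨N, hN⟩ := Metric.cauchySeq_iff.1 hy.cauchySeq (ε / (2 * (t + 1))) (by positivity)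
  refine ⟨N, fun m hm n hn => ?_⟩
  have h1 := hN m hm n hn
  rw [dist_eq_norm] at h1 hxz ⊢
  have h2 := (hB m).norm_exp_sub_le (hB n) (hcomm m n) ht z
  have h3 := (hB m).norm_apply_le ht (x - z)
  have h4 := (hB n).norm_apply_le ht (x - z)
  have h5 : t * ‖B m z - B n z‖ ≤ ε / 2 := by
    calc t * ‖B m z - B n z‖ ≤ (t + 1) * (ε / (2 * (t + 1))) := by gcongr; linarith
      _ = ε / 2 := by field_simp
  have e : exp ((t : 𝕜) • B m) x - exp ((t : 𝕜) • B n) x =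
      exp ((t : 𝕜) • B m) (x - z) + (exp ((t : 𝕜) • B m) z - exp ((t : 𝕜) • B n) z)
        - exp ((t : 𝕜) • B n) (x - z) := by
    rw [map_sub, map_sub]; abel
  rw [e]
  have h6 := norm_sub_le (exp ((t : 𝕜) • B m) (x - z) +
    (exp ((t : 𝕜) • B m) z - exp ((t : 𝕜) • B n) z)) (exp ((t : 𝕜) • B n) (x - z))
  have h7 := norm_add_le (exp ((t : 𝕜) • B m) (x - z))
    (exp ((t : 𝕜) • B m) z - exp ((t : 𝕜) • B n) z)
  linarith

/-- Commuting contraction semigroups `exp (t B n)` whose generators converge on a dense set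
converge to a contraction semigroup, and the limit of `B n` is the derivative of the orbits. -/
theorem exists_contractionSemigroup_of_tendsto {B : ℕ → X →L[𝕜] X}
    (hB : ∀ n, (B n).IsExpContractive) (hcomm : ∀ m n, Commute (B m) (B n))
    {D : Set X} (hD : Dense D)
    (hlim : ∀ z ∈ D, ∃ y, Tendsto (fun n => B n z) atTop (𝓝 y)) :
    ∃ T : C0Semigroup 𝕜 X, (∀ t, ‖T.toFun t‖ ≤ 1) ∧
      ∀ x y, Tendsto (fun n => B n x) atTop (𝓝 y) →
        Tendsto (fun t : ℝ≥0 => ((t : ℝ) : 𝕜)⁻¹ • (T.toFun t x - x)) (𝓝[>] 0) (𝓝 y) := by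
  choose f hf using fun (t : ℝ≥0) (x : X) =>
    exists_tendsto_exp_apply hB hcomm hD hlim t.coe_nonneg x
  let S : ℝ≥0 → X →L[𝕜] X := fun t =>
    (linearMapOfTendsto (f t)
      (fun n => (exp (((t : ℝ) : 𝕜) • B n) : X →L[𝕜] X).toLinearMap)
      (tendsto_pi_nhds.2 (hf t))).mkContinuous 1 fun x => by
        rw [one_mul]
        exact le_of_tendsto (hf t x).norm
          (Eventually.of_forall fun n => (hB n).norm_apply_le t.coe_nonneg x)
  have hS : ∀ (t : ℝ≥0) (x : X), Tendsto (fun n => exp (((t : ℝ) : 𝕜) • B n) x) atTop (𝓝 (S t x)) := hf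
  have hS1 : ∀ t, ‖S t‖ ≤ 1 := fun t => LinearMap.mkContinuous_norm_le _ zero_le_one _
  have hadd : ∀ s t, S (s + t) = S s * S t := by
    intro s t
    ext x
    refine tendsto_nhds_unique (hS (s + t) x) ?_
    -- Strong limits respect products here because the left factors are uniformly bounded.
    have h1 : Tendsto (fun n => exp (((s : ℝ) : 𝕜) • B n)
        (exp (((t : ℝ) : 𝕜) • B n) x - S t x)) atTop (𝓝 0) := by
      refine squeeze_zero_norm (fun n => (hB n).norm_apply_le s.coe_nonneg _) ?_
      simpa using ((hS t x).sub_const (S t x)).norm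
    have h3 := h1.add (hS s (S t x))
    rw [zero_add] at h3
    refine h3.congr fun n => ?_
    have h2 : exp ((((s + t : ℝ≥0) : ℝ) : 𝕜) • B n) =
        exp (((s : ℝ) : 𝕜) • B n) * exp (((t : ℝ) : 𝕜) • B n) := by
      rw [← ContinuousLinearMap.exp_add_of_commute
        (((Commute.refl (B n)).smul_left _).smul_right _), ← add_smul]
      push_cast
      rfl
    rw [h2, mul_apply_eq_comp, map_sub]
    exact sub_add_cancel _ _
  have hlip : ∀ z ∈ D, ∃ C : ℝ≥0, ∀ t, ‖S t z - z‖ ≤ C * t := by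
    intro z hz
    obtain ⟨y, hy⟩ := hlim z hz
    refine ⟨‖y‖₊, fun t => ?_⟩
    rw [coe_nnnorm, mul_comm]
    exact le_of_tendsto_of_tendsto' ((hS t z).sub_const z).norm (hy.norm.const_mul (t : ℝ))
      fun n => (hB n).norm_exp_sub_self_le t.coe_nonneg z
  refine ⟨⟨S, ?_, hadd, continuous_orbit_of_dense hadd hS1 hD hlip⟩, hS1, fun x y hxy => ?_⟩
  · ext x
    refine tendsto_nhds_unique (hS 0 x) ?_
    simp
  rw [Metric.tendsto_nhds]
  intro ε hε
  obtain ⟨z, hz, hyz⟩ := hD.exists_dist_lt y (show 0 < ε / 4 by positivity)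
  obtain ⟨w, hw⟩ := hlim z hz
  have hsmall : ∀ᶠ t : ℝ≥0 in 𝓝[>] 0, (t : ℝ) * ‖w‖ < ε / 2 := by
    have h0 : Tendsto (fun t : ℝ≥0 => (t : ℝ) * ‖w‖) (𝓝[>] 0) (𝓝 0) := by
      have : Continuous fun t : ℝ≥0 => (t : ℝ) * ‖w‖ := by fun_prop
      simpa using (this.tendsto 0).mono_left nhdsWithin_le_nhds
    exact h0.eventually_lt_const (by positivity)
  filter_upwards [hsmall, self_mem_nhdsWithin] with t ht ht0
  have ht0' : (0 : ℝ) < t := NNReal.coe_pos.2 ht0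
  have htk : ((t : ℝ) : 𝕜) ≠ 0 := by exact_mod_cast ht0'.ne'
  -- The Taylor estimate is uniform in `n`, so it survives the limit; after division by `t` it
  -- leaves less than `2 · ε/4 + ε/2`.
  have h1 : ‖S t x - x - ((t : ℝ) : 𝕜) • y‖ ≤ t * (2 * ‖y - z‖ + t * ‖w‖) :=
    le_of_tendsto_of_tendsto'
      (((hS t x).sub_const x).sub (hxy.const_smul ((t : ℝ) : 𝕜))).norm
      ((((hxy.sub_const z).norm.const_mul 2).add (hw.norm.const_mul (t : ℝ))).const_mul (t : ℝ))
      fun n => (hB n).norm_exp_sub_self_sub_smul_le t.coe_nonneg x z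
  have e : ((t : ℝ) : 𝕜)⁻¹ • (S t x - x) - y =
      ((t : ℝ) : 𝕜)⁻¹ • (S t x - x - ((t : ℝ) : 𝕜) • y) := by
    rw [smul_sub _ (S t x - x), smul_smul, inv_mul_cancel₀ htk, one_smul]
  rw [dist_eq_norm] at hyz ⊢
  change ‖((t : ℝ) : 𝕜)⁻¹ • (S t x - x) - y‖ < ε
  rw [e, norm_smul, norm_inv, RCLike.norm_ofReal, abs_of_pos ht0']
  calc (t : ℝ)⁻¹ * ‖S t x - x - ((t : ℝ) : 𝕜) • y‖
      ≤ (t : ℝ)⁻¹ * (t * (2 * ‖y - z‖ + t * ‖w‖)) := by gcongr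
    _ = 2 * ‖y - z‖ + t * ‖w‖ := by field_simp
    _ < ε := by linarith

end LimitSemigroup

/-! ### The Laplace transform of a contraction semigroup. -/

section Laplace

open MeasureTheory Set

variable {𝕜 X : Type*} [RCLike 𝕜] [NormedAddCommGroup X] [NormedSpace 𝕜 X]

namespace C0Semigroup

/-- `y` is the right derivative at `0` of the orbit of `x`. -/
def HasOrbitDeriv (T : C0Semigroup 𝕜 X) (x y : X) : Prop :=
  Tendsto (fun t : ℝ≥0 => ((t : ℝ) : 𝕜)⁻¹ • (T.toFun t x - x)) (𝓝[>] 0) (𝓝 y)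

theorem HasOrbitDeriv.unique {T : C0Semigroup 𝕜 X} {x y z : X} (hy : T.HasOrbitDeriv x y)
    (hz : T.HasOrbitDeriv x z) : y = z :=
  tendsto_nhds_unique hy hz

theorem HasOrbitDeriv.map {T : C0Semigroup 𝕜 X} {x y : X} (h : T.HasOrbitDeriv x y)
    {R : X →L[𝕜] X} (hR : ∀ t, Commute R (T.toFun t)) : T.HasOrbitDeriv (R x) (R y) := by
  refine ((R.continuous.tendsto y).comp h).congr fun t => ?_
  have := DFunLike.congr_fun (hR t).eq x
  simp only [mul_apply_eq_comp] at this
  simp [this]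

theorem norm_apply_le {T : C0Semigroup 𝕜 X} (hT : ∀ t, ‖T.toFun t‖ ≤ 1) (t : ℝ≥0) (x : X) :
    ‖T.toFun t x‖ ≤ ‖x‖ := by
  simpa using ContinuousLinearMap.le_of_opNorm_le _ (hT t) x

variable [NormedSpace ℝ X]

/-- The integrand `exp (-a t) T(t) x` of the Laplace transform. -/
noncomputable def laplaceIntegrand (T : C0Semigroup 𝕜 X) (a : ℝ) (x : X) (t : ℝ) : X :=
  Real.exp (-a * t) • T.toFun t.toNNReal x

theorem continuous_laplaceIntegrand (T : C0Semigroup 𝕜 X) (a : ℝ) (x : X) :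
    Continuous (T.laplaceIntegrand a x) :=
  (by fun_prop : Continuous fun t : ℝ => Real.exp (-a * t)).smul
    ((T.continuous_orbit x).comp continuous_real_toNNReal)

theorem norm_laplaceIntegrand_le {T : C0Semigroup 𝕜 X} (hT : ∀ t, ‖T.toFun t‖ ≤ 1) (a : ℝ) (x : X)
    (t : ℝ) : ‖T.laplaceIntegrand a x t‖ ≤ Real.exp (-a * t) * ‖x‖ := by
  rw [laplaceIntegrand, norm_smul, Real.norm_eq_abs, Real.abs_exp]
  gcongr
  exact norm_apply_le hT _ _

theorem integrableOn_laplaceIntegrand {T : C0Semigroup 𝕜 X} (hT : ∀ t, ‖T.toFun t‖ ≤ 1) {a : ℝ}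
    (ha : 0 < a) (x : X) (c : ℝ) : IntegrableOn (T.laplaceIntegrand a x) (Ioi c) :=
  ((exp_neg_integrableOn_Ioi c ha).mul_const ‖x‖).mono'
    (T.continuous_laplaceIntegrand a x).aestronglyMeasurable
    (Eventually.of_forall fun t => norm_laplaceIntegrand_le hT a x t)

variable [IsScalarTower ℝ 𝕜 X]

theorem apply_laplaceIntegrand (T : C0Semigroup 𝕜 X) (a : ℝ) (x : X) (h : ℝ≥0) {t : ℝ}
    (ht : 0 ≤ t) : T.toFun h (T.laplaceIntegrand a x t) =
      Real.exp (a * h) • T.laplaceIntegrand a x (t + h) := by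
  have e : (t + h).toNNReal = h + t.toNNReal := by
    rw [Real.toNNReal_add ht h.coe_nonneg, Real.toNNReal_coe, add_comm]
  rw [laplaceIntegrand, laplaceIntegrand, e, T.map_add, mul_apply_eq_comp,
    (T.toFun h).map_smul_of_tower, smul_smul, ← Real.exp_add]
  congr 2
  ring

theorem laplaceIntegrand_apply (T : C0Semigroup 𝕜 X) (a : ℝ) (x : X) (h : ℝ≥0) (t : ℝ) :
    T.laplaceIntegrand a (T.toFun h x) t = T.toFun h (T.laplaceIntegrand a x t) := by
  rw [laplaceIntegrand, laplaceIntegrand, (T.toFun h).map_smul_of_tower, ← mul_apply_eq_comp,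
    ← T.map_add, add_comm, T.map_add, mul_apply_eq_comp]

/-- The Laplace transform of a contraction semigroup. -/
noncomputable def laplace (T : C0Semigroup 𝕜 X) (hT : ∀ t, ‖T.toFun t‖ ≤ 1) {a : ℝ} (ha : 0 < a) :
    X →L[𝕜] X :=
  LinearMap.mkContinuous
    { toFun := fun x => ∫ t in Ioi 0, T.laplaceIntegrand a x t
      map_add' := fun x y => by
        rw [← integral_add (integrableOn_laplaceIntegrand hT ha x 0)
          (integrableOn_laplaceIntegrand hT ha y 0)]
        simp [laplaceIntegrand]
      map_smul' := fun c x => by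
        rw [RingHom.id_apply, ← integral_smul]
        simp only [laplaceIntegrand, map_smul, smul_comm c] }
    a⁻¹ fun x => by
      refine (norm_integral_le_of_norm_le ((exp_neg_integrableOn_Ioi 0 ha).mul_const ‖x‖)
        (Eventually.of_forall fun t => norm_laplaceIntegrand_le hT a x t)).trans_eq ?_
      rw [integral_mul_const, integral_exp_mul_Ioi (neg_lt_zero.2 ha)]
      simp

theorem laplace_apply (T : C0Semigroup 𝕜 X) (hT : ∀ t, ‖T.toFun t‖ ≤ 1) {a : ℝ} (ha : 0 < a)
    (x : X) : T.laplace hT ha x = ∫ t in Ioi 0, T.laplaceIntegrand a x t := rfl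

theorem norm_laplace_le (T : C0Semigroup 𝕜 X) (hT : ∀ t, ‖T.toFun t‖ ≤ 1) {a : ℝ} (ha : 0 < a) :
    ‖T.laplace hT ha‖ ≤ a⁻¹ :=
  LinearMap.mkContinuous_norm_le _ (inv_nonneg.2 ha.le) _

variable [CompleteSpace X]

theorem apply_laplace (T : C0Semigroup 𝕜 X) (hT : ∀ t, ‖T.toFun t‖ ≤ 1) {a : ℝ} (ha : 0 < a)
    (h : ℝ≥0) (x : X) : T.toFun h (T.laplace hT ha x) =
      ∫ t in Ioi 0, T.toFun h (T.laplaceIntegrand a x t) :=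
  (ContinuousLinearMap.integral_comp_comm _ (integrableOn_laplaceIntegrand hT ha x 0)).symm

theorem commute_laplace (T : C0Semigroup 𝕜 X) (hT : ∀ t, ‖T.toFun t‖ ≤ 1) {a : ℝ} (ha : 0 < a)
    (h : ℝ≥0) : Commute (T.laplace hT ha) (T.toFun h) := by
  ext x
  rw [mul_apply_eq_comp, mul_apply_eq_comp, apply_laplace, laplace_apply]
  simp_rw [laplaceIntegrand_apply]

/-- Applying `T(h)` shifts the integrand by `h` at the cost of a factor `exp (a h)`, leaving the
integral over `(h, ∞)`. The right side can be differentiated in `h` by calculus alone. -/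
theorem apply_laplace_eq (T : C0Semigroup 𝕜 X) (hT : ∀ t, ‖T.toFun t‖ ≤ 1) {a : ℝ} (ha : 0 < a)
    (h : ℝ≥0) (x : X) : T.toFun h (T.laplace hT ha x) =
      Real.exp (a * h) • (T.laplace hT ha x - ∫ t in (0 : ℝ)..h, T.laplaceIntegrand a x t) := by
  rw [apply_laplace, setIntegral_congr_fun measurableSet_Ioi
    (fun t ht => T.apply_laplaceIntegrand a x h (le_of_lt ht)), integral_smul, laplace_apply,
    ← intervalIntegral.integral_Ioi_sub_Ioi (integrableOn_laplaceIntegrand hT ha x 0) h.coe_nonneg,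
    sub_sub_cancel]
  congr 1
  have := (measurePreserving_add_right volume (h : ℝ)).setIntegral_preimage_emb
    (measurableEmbedding_addRight (h : ℝ)) (T.laplaceIntegrand a x) (Ioi (h : ℝ))
  simpa using this

/-- Product rule at `h = 0` in `apply_laplace_eq`. This makes the Laplace transform a right inverse
of `a` minus the generator. -/
theorem hasOrbitDeriv_laplace (T : C0Semigroup 𝕜 X) (hT : ∀ t, ‖T.toFun t‖ ≤ 1) {a : ℝ}
    (ha : 0 < a) (x : X) :
    T.HasOrbitDeriv (T.laplace hT ha x) ((a : 𝕜) • T.laplace hT ha x - x) := by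
  have hint : HasDerivAt (fun u : ℝ => ∫ t in (0 : ℝ)..u, T.laplaceIntegrand a x t) x 0 := by
    have hc := T.continuous_laplaceIntegrand a x
    refine (intervalIntegral.integral_hasDerivAt_right (hc.intervalIntegrable _ _)
      hc.aestronglyMeasurable.stronglyMeasurableAtFilter hc.continuousAt).congr_deriv ?_
    simp [laplaceIntegrand, T.map_zero]
  have hexp : HasDerivAt (fun u : ℝ => Real.exp (a * u)) a 0 := by
    simpa using ((hasDerivAt_id (0 : ℝ)).const_mul a).exp
  have hF := (hexp.smul (hint.const_sub (T.laplace hT ha x))).tendsto_slope_zero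
  have hcoe : Tendsto (fun t : ℝ≥0 => (t : ℝ)) (𝓝[>] 0) (𝓝[≠] 0) := by
    refine tendsto_nhdsWithin_of_tendsto_nhds_of_eventually_within _ ?_ ?_
    · exact (NNReal.continuous_coe.tendsto' 0 0 rfl).mono_left nhdsWithin_le_nhds
    · filter_upwards [self_mem_nhdsWithin] with t ht
      exact NNReal.coe_ne_zero.2 (ne_of_gt ht)
  have hlim := hF.comp hcoe
  simp only [intervalIntegral.integral_same, mul_zero, Real.exp_zero, one_smul, sub_zero,
    smul_neg] at hlim
  have e : (a : 𝕜) • T.laplace hT ha x - x = -x + a • T.laplace hT ha x := by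
    rw [← RCLike.real_smul_eq_coe_smul (K := 𝕜)]; abel
  rw [e]
  refine hlim.congr fun t => ?_
  rw [apply_laplace_eq, ← RCLike.ofReal_inv, ← RCLike.real_smul_eq_coe_smul (K := 𝕜)]
  simp

/-- The left inverse property: with `L` the transform, which commutes with the semigroup, the orbit
of `L x` has derivative `L y`, but also `a L x - x`. -/
theorem HasOrbitDeriv.laplace_eq {T : C0Semigroup 𝕜 X} (hT : ∀ t, ‖T.toFun t‖ ≤ 1) {a : ℝ}
    (ha : 0 < a) {x y : X} (h : T.HasOrbitDeriv x y) :
    T.laplace hT ha ((a : 𝕜) • x - y) = x := by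
  have := (h.map (T.commute_laplace hT ha)).unique (T.hasOrbitDeriv_laplace hT ha x)
  rw [map_sub, map_smul, this, sub_sub_cancel]

end C0Semigroup

end Laplace

/-! ### Resolvents, Cayley transforms and Yosida approximations. -/

namespace UnboundedOperator

variable {𝕜 X : Type*} [RCLike 𝕜] [NormedAddCommGroup X] [NormedSpace 𝕜 X]

/-- `R` is the resolvent `(z I - A)⁻¹`. -/
structure IsResolvent (A : X →ₗ.[𝕜] X) (z : 𝕜) (R : X →L[𝕜] A.domain) : Prop where
  left_inv : ∀ x : A.domain, R (z • (x : X) - A x) = x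
  right_inv : ∀ y : X, z • (R y : X) - A (R y) = y

theorem affine_neg_one_apply (A : X →ₗ.[𝕜] X) (z : 𝕜) (x : A.domain) :
    affine A (-1) z x = z • (x : X) - A x := by
  change (-1 : 𝕜) • A x + z • (x : X) = _
  module

theorem mem_resolventSet_iff (A : X →ₗ.[𝕜] X) (z : 𝕜) :
    z ∈ resolventSet A ↔ ∃ R, IsResolvent A z R := by
  refine exists_congr fun R => ⟨fun h => ⟨fun x => ?_, fun y => ?_⟩, fun h => ⟨fun x => ?_,
    fun y => ?_⟩⟩
  · rw [← affine_neg_one_apply]; exact h.1 x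
  · rw [← affine_neg_one_apply]; exact h.2 y
  · rw [affine_neg_one_apply]; exact h.left_inv x
  · rw [affine_neg_one_apply]; exact h.right_inv y

theorem cayley_apply {A : X →ₗ.[𝕜] X} {τ : ℝ} (hτ : 0 < τ)
    (h : ((τ⁻¹ : ℝ) : 𝕜) ∈ resolventSet A) {R : X →L[𝕜] A.domain}
    (hR : IsResolvent A ((τ⁻¹ : ℝ) : 𝕜) R) (y : X) :
    cayley A hτ h y = y + (2 : 𝕜) • (R ((-τ : 𝕜)⁻¹ • y) : X) := by
  have h0 : (-τ : 𝕜) ≠ 0 := neg_ne_zero.mpr (by exact_mod_cast hτ.ne')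
  obtain ⟨x, rfl⟩ := (bijective_affine A hτ h).2 y
  have hx : R ((-τ : 𝕜)⁻¹ • affine A (τ : 𝕜) (-1) x) = x := by
    rw [affine_eq A hτ, smul_smul, inv_mul_cancel₀ h0, one_smul, affine_neg_one_apply,
      hR.left_inv]
  have hs : (LinearEquiv.ofBijective _ (bijective_affine A hτ h)).symm
      (affine A (τ : 𝕜) (-1) x) = x :=
    (LinearEquiv.ofBijective _ (bijective_affine A hτ h)).symm_apply_apply x
  rw [hx]
  change cayleyLinear A hτ h _ = _
  simp only [cayleyLinear, LinearMap.comp_apply, LinearEquiv.coe_coe, hs]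
  simp only [affine, LinearMap.add_apply, LinearMap.smul_apply, Submodule.subtype_apply]
  module

theorem norm_cayley_sub_one_le_iff {A : X →ₗ.[𝕜] X} {τ : ℝ} (hτ : 0 < τ)
    (h : ((τ⁻¹ : ℝ) : 𝕜) ∈ resolventSet A) {R : X →L[𝕜] A.domain}
    (hR : IsResolvent A ((τ⁻¹ : ℝ) : 𝕜) R) :
    ‖cayley A hτ h - 1‖ ≤ 2 ↔ ∀ y, ‖(R y : X)‖ ≤ τ * ‖y‖ := by
  have key : ∀ y, ‖(cayley A hτ h - 1) y‖ = 2 * (τ⁻¹ * ‖(R y : X)‖) := by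
    intro y
    rw [_root_.sub_apply, one_apply_eq_self, cayley_apply hτ h hR,
      add_sub_cancel_left, map_smul, Submodule.coe_smul, norm_smul, norm_smul, norm_inv, norm_neg,
      RCLike.norm_ofReal, abs_of_pos hτ, RCLike.norm_ofNat]
  rw [ContinuousLinearMap.opNorm_le_iff zero_le_two]
  refine forall_congr' fun y => ?_
  rw [key, mul_le_mul_iff_right₀ two_pos, inv_mul_le_iff₀ hτ]

section Yosida

variable {A : X →ₗ.[𝕜] X}

/-- The resolvent identity, obtained by applying `R` to `y = (z - A) S y + (w - z) S y`. -/
theorem IsResolvent.sub_eq {z w : 𝕜} {R S : X →L[𝕜] A.domain} (hR : IsResolvent A z R)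
    (hS : IsResolvent A w S) (y : X) : R y - S y = (w - z) • R (S y) := by
  have h1 : y = (z • (S y : X) - A (S y)) + (w - z) • (S y : X) := by
    conv_lhs => rw [← hS.right_inv y]
    module
  have h2 : R y = S y + (w - z) • R (S y) := by
    conv_lhs => rw [h1, map_add, hR.left_inv, map_smul]
  rw [h2, add_sub_cancel_left]

/-- The resolvent as an operator on `X`. -/
def toEnd (R : X →L[𝕜] A.domain) : X →L[𝕜] X := A.domain.subtypeL.comp R

theorem toEnd_apply (R : X →L[𝕜] A.domain) (y : X) : toEnd R y = R y := rfl

theorem IsResolvent.commute {z w : 𝕜} {R S : X →L[𝕜] A.domain} (hR : IsResolvent A z R)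
    (hS : IsResolvent A w S) : Commute (toEnd R) (toEnd S) := by
  ext y
  simp only [mul_apply_eq_comp, toEnd_apply]
  rcases eq_or_ne z w with rfl | hzw
  · have h : ∀ y, R y = S y := fun y => by
      rw [← sub_eq_zero, hR.sub_eq hS y, sub_self, zero_smul]
    rw [h, h]
  · have h : (w - z) • R (S y) = (w - z) • S (R y) := by
      rw [← hR.sub_eq hS y, ← neg_sub z w, neg_smul, ← hS.sub_eq hR y, neg_sub]
    rw [smul_right_injective _ (sub_ne_zero.2 hzw.symm) h]

/-- The Yosida approximation `a² R - a I` of `A`, where `R = (a I - A)⁻¹`. -/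
noncomputable def yosida (a : ℝ) (R : X →L[𝕜] A.domain) : X →L[𝕜] X :=
  ((a ^ 2 : ℝ) : 𝕜) • toEnd R - (a : 𝕜) • (1 : X →L[𝕜] X)

/-- The summand `t a² R` has norm at most `t a`, which the scalar part `-t a` compensates exactly.
-/
theorem yosida_isExpContractive [CompleteSpace X] {a : ℝ} (ha : 0 < a) {R : X →L[𝕜] A.domain}
    (hR : ∀ y, ‖(R y : X)‖ ≤ a⁻¹ * ‖y‖) : (yosida a R).IsExpContractive := by
  intro t ht
  have e : (t : 𝕜) • yosida a R = ((t * a ^ 2 : ℝ) : 𝕜) • toEnd R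
      - ((t * a : ℝ) : 𝕜) • (1 : X →L[𝕜] X) := by
    rw [yosida, smul_sub, smul_smul, smul_smul, RCLike.ofReal_mul, RCLike.ofReal_mul]
  rw [e]
  refine ContinuousLinearMap.norm_exp_sub_smul_one_le _ ?_
  have h1 : ‖toEnd R‖ ≤ a⁻¹ := ContinuousLinearMap.opNorm_le_bound _ (inv_nonneg.2 ha.le) hR
  rw [norm_smul, RCLike.norm_ofReal, abs_of_nonneg (by positivity)]
  calc t * a ^ 2 * ‖toEnd R‖ ≤ t * a ^ 2 * a⁻¹ := by gcongr
    _ = t * a := by field_simp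

theorem IsResolvent.commute_yosida {a b : ℝ} {R S : X →L[𝕜] A.domain}
    (hR : IsResolvent A (a : 𝕜) R) (hS : IsResolvent A (b : 𝕜) S) :
    Commute (yosida a R) (yosida b S) := by
  have h1 : Commute (toEnd R) (yosida b S) :=
    ((hR.commute hS).smul_right _).sub_right ((Commute.one_right _).smul_right _)
  exact (h1.smul_left _).sub_left ((Commute.one_left _).smul_left _)

/-- On `D(A)` one has `a R - I = R A`. This reduces the convergence of the Yosida approximations to
`a R → I` strongly. -/
theorem IsResolvent.yosida_apply {a : ℝ} {R : X →L[𝕜] A.domain}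
    (hR : IsResolvent A (a : 𝕜) R) (x : A.domain) :
    yosida a R x = (a : 𝕜) • (R (A x) : X) := by
  have h1 := congrArg (Subtype.val) (hR.left_inv x)
  rw [map_sub, map_smul, Submodule.coe_sub, Submodule.coe_smul, sub_eq_iff_eq_add] at h1
  simp only [yosida, _root_.sub_apply, _root_.smul_apply, toEnd_apply,
    one_apply_eq_self]
  rw [RCLike.ofReal_pow, pow_two, mul_smul, h1]
  module

/-- For `z ∈ D(A)` the error `a R z - z = R (A z)` is at most `‖A z‖ / a`; density suffices since `a
R` is a contraction. -/
theorem tendsto_smul_resolvent (hA : Dense (A.domain : Set X)) {a : ℕ → ℝ} (ha0 : ∀ n, 0 < a n)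
    (ha : Tendsto a atTop atTop) {R : ℕ → X →L[𝕜] A.domain}
    (hR : ∀ n, IsResolvent A (a n : 𝕜) (R n))
    (hRb : ∀ n y, ‖(R n y : X)‖ ≤ (a n)⁻¹ * ‖y‖) (y : X) :
    Tendsto (fun n => (a n : 𝕜) • (R n y : X)) atTop (𝓝 y) := by
  rw [Metric.tendsto_nhds]
  intro ε hε
  obtain ⟨z, hz, hyz⟩ := hA.exists_dist_lt y (show 0 < ε / 4 by positivity)
  lift z to A.domain using hz
  have hsmall : ∀ᶠ n in atTop, (a n)⁻¹ * ‖A z‖ < ε / 4 := by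
    have h0 : Tendsto (fun n => (a n)⁻¹ * ‖A z‖) atTop (𝓝 0) := by
      simpa using (tendsto_inv_atTop_zero.comp ha).mul_const ‖A z‖
    exact h0.eventually_lt_const (by positivity)
  filter_upwards [hsmall] with n hn
  have h1 := congrArg (Subtype.val) ((hR n).left_inv z)
  rw [map_sub, map_smul, Submodule.coe_sub, Submodule.coe_smul, sub_eq_iff_eq_add] at h1
  have h2 : ‖(a n : 𝕜) • (R n (y - z) : X)‖ ≤ ‖y - z‖ := by
    rw [norm_smul, RCLike.norm_ofReal, abs_of_pos (ha0 n)]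
    calc a n * ‖(R n (y - z) : X)‖ ≤ a n * ((a n)⁻¹ * ‖y - z‖) := by
          gcongr
          · exact (ha0 n).le
          · exact hRb n _
      _ = ‖y - z‖ := mul_inv_cancel_left₀ (ha0 n).ne' _
  have e : (a n : 𝕜) • (R n y : X) - y =
      (a n : 𝕜) • (R n (y - z) : X) + (R n (A z) : X) - (y - z) := by
    rw [map_sub, Submodule.coe_sub, smul_sub, h1]
    abel
  rw [dist_eq_norm] at hyz ⊢
  rw [e]
  have h3 := norm_sub_le ((a n : 𝕜) • (R n (y - z) : X) + (R n (A z) : X)) (y - z)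
  have h4 := norm_add_le ((a n : 𝕜) • (R n (y - z) : X)) (R n (A z) : X)
  have h5 := hRb n (A z)
  linarith

end Yosida

/-! ### The Hille–Yosida theorem for contractions. -/

section HilleYosida

variable [CompleteSpace X] [NormedSpace ℝ X] [IsScalarTower ℝ 𝕜 X]

/-- The Laplace transform of a contraction semigroup is the resolvent of its generator. -/
theorem exists_isResolvent_of_isGenerator {A : X →ₗ.[𝕜] X} {T : C0Semigroup 𝕜 X}
    (hT : ∀ t, ‖T.toFun t‖ ≤ 1) (hgen : T.IsGenerator A) {a : ℝ} (ha : 0 < a) :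
    ∃ R : X →L[𝕜] A.domain, IsResolvent A (a : 𝕜) R ∧ ∀ y, ‖(R y : X)‖ ≤ a⁻¹ * ‖y‖ := by
  have hgr : ∀ y, ∃ x : A.domain, (x : X) = T.laplace hT ha y ∧
      A x = (a : 𝕜) • T.laplace hT ha y - y := fun y =>
    (LinearPMap.mem_graph_iff A).1 ((hgen _ _).2 (T.hasOrbitDeriv_laplace hT ha y))
  have hmem : ∀ y, T.laplace hT ha y ∈ A.domain := fun y => by
    obtain ⟨x, hx, -⟩ := hgr y
    exact hx ▸ x.2
  refine ⟨(T.laplace hT ha).codRestrict A.domain hmem, ⟨fun x => ?_, fun y => ?_⟩, fun y => ?_⟩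
  · have hx : T.HasOrbitDeriv x (A x) := (hgen _ _).1 (A.mem_graph x)
    exact Subtype.ext (hx.laplace_eq hT ha)
  · obtain ⟨x, hx, hAx⟩ := hgr y
    have e : (T.laplace hT ha).codRestrict A.domain hmem y = x := Subtype.ext hx.symm
    rw [e, hAx, hx, sub_sub_cancel]
  · exact ContinuousLinearMap.le_of_opNorm_le _ (T.norm_laplace_le hT ha) y

/-- The sufficiency part of the Hille–Yosida theorem for contraction semigroups. -/
theorem generatesContractionSemigroup_of_resolvent {A : X →ₗ.[𝕜] X}
    (hA : Dense (A.domain : Set X)) {a : ℕ → ℝ} (ha0 : ∀ n, 0 < a n)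
    (ha : Tendsto a atTop atTop) {R : ℕ → X →L[𝕜] A.domain}
    (hR : ∀ n, IsResolvent A (a n : 𝕜) (R n))
    (hRb : ∀ n y, ‖(R n y : X)‖ ≤ (a n)⁻¹ * ‖y‖) : GeneratesContractionSemigroup A := by
  have hlim : ∀ x : A.domain, Tendsto (fun n => yosida (a n) (R n) x) atTop (𝓝 (A x)) :=
    fun x => (tendsto_smul_resolvent hA ha0 ha hR hRb (A x)).congr
      fun n => ((hR n).yosida_apply x).symm
  obtain ⟨T, hT, hderiv⟩ := exists_contractionSemigroup_of_tendsto
    (fun n => yosida_isExpContractive (ha0 n) (hRb n))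
    (fun m n => (hR m).commute_yosida (hR n)) hA (fun z hz => ⟨_, hlim ⟨z, hz⟩⟩)
  have hsub : ∀ x : A.domain, T.HasOrbitDeriv x (A x) := fun x => hderiv _ _ (hlim x)
  refine ⟨T, hT, fun x y => ⟨fun hxy => ?_, fun (hxy : T.HasOrbitDeriv x y) => ?_⟩⟩
  · obtain ⟨w, rfl, rfl⟩ := (LinearPMap.mem_graph_iff A).1 hxy
    exact hsub w
  -- The generator is no larger than `A`: both `x` and `w` are the Laplace transform of `a 0 • x -
  -- y`, so `x = w ∈ D(A)`.
  · set w : A.domain := R 0 ((a 0 : 𝕜) • x - y)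
    have h1 := (hsub w).laplace_eq hT (ha0 0)
    rw [(hR 0).right_inv, hxy.laplace_eq hT (ha0 0)] at h1
    rw [hxy.unique (h1 ▸ hsub w), h1]
    exact A.mem_graph w

end HilleYosida

end UnboundedOperator

/-! ### The equivalence of the three conditions. -/

theorem proposition3p1 {𝕜 X : Type*} [RCLike 𝕜] [NormedAddCommGroup X] [NormedSpace 𝕜 X]
    [CompleteSpace X] (A : X →ₗ.[𝕜] X) (hA : Dense (A.domain : Set X)) :
    List.TFAE [
      GeneratesContractionSemigroup A,
      ∃ hρ : ∀ t : ℝ, 0 < t → (t : 𝕜) ∈ UnboundedOperator.resolventSet A,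
        ∀ (τ : ℝ) (hτ : 0 < τ),
          ‖UnboundedOperator.cayley A hτ (hρ τ⁻¹ (inv_pos.mpr hτ)) - 1‖ ≤ 2,
      ∃ τ₀ : ℝ, 0 < τ₀ ∧
        ∃ hρ : ∀ t : ℝ, 1 / τ₀ < t → (t : 𝕜) ∈ UnboundedOperator.resolventSet A,
          ∀ (τ : ℝ) (hτ : 0 < τ) (hτ₀ : τ < τ₀),
            ‖UnboundedOperator.cayley A hτ
              (hρ τ⁻¹ (one_div τ ▸ one_div_lt_one_div_of_lt hτ hτ₀)) - 1‖ ≤ 2] := by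
  -- Derivatives in real time and Bochner integrals need a real structure compatible with `𝕜`.
  let _ : NormedSpace ℝ X := NormedSpace.restrictScalars ℝ 𝕜 X
  have : IsScalarTower ℝ 𝕜 X := ⟨fun r c x => by
    change (r • c) • x = (algebraMap ℝ 𝕜 r) • (c • x)
    rw [Algebra.smul_def, mul_smul]⟩
  tfae_have 1 → 2 := by
    rintro ⟨T, hT, hgen⟩
    have hres := fun (t : ℝ) (ht : 0 < t) =>
      UnboundedOperator.exists_isResolvent_of_isGenerator hT hgen ht
    refine ⟨fun t ht => (UnboundedOperator.mem_resolventSet_iff A _).2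
      ((hres t ht).imp fun _ h => h.1), fun τ hτ => ?_⟩
    obtain ⟨R, hR, hRb⟩ := hres τ⁻¹ (inv_pos.2 hτ)
    rw [inv_inv] at hRb
    exact (UnboundedOperator.norm_cayley_sub_one_le_iff hτ _ hR).2 hRb
  tfae_have 2 → 3 := by
    rintro ⟨hρ, hV⟩
    exact ⟨1, one_pos, fun t ht => hρ t (one_pos.trans (by simpa using ht)),
      fun τ hτ _ => hV τ hτ⟩
  tfae_have 3 → 1 := by
    rintro ⟨τ₀, hτ₀, hρ, hV⟩
    -- Any sequence in `(1/τ₀, ∞)` tending to infinity would do; `n + 1` keeps the inequality strict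
    -- at `n = 0`.
    have hlt : ∀ n : ℕ, 1 / τ₀ < 1 / τ₀ + (n + 1) := fun n => lt_add_of_pos_right _ (by positivity)
    choose R hR using fun n : ℕ =>
      (UnboundedOperator.mem_resolventSet_iff A _).1 (hρ (1 / τ₀ + (n + 1)) (hlt n))
    have hpos : ∀ n : ℕ, 0 < 1 / τ₀ + ((n : ℝ) + 1) := fun n => by positivity
    refine UnboundedOperator.generatesContractionSemigroup_of_resolvent hA
      (a := fun n : ℕ => 1 / τ₀ + (n + 1)) hpos ?_ hR fun n => ?_
    · exact tendsto_atTop_add_const_left _ _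
        (tendsto_atTop_add_const_right _ _ tendsto_natCast_atTop_atTop)
    · have hτ : (1 / τ₀ + ((n : ℝ) + 1))⁻¹ < τ₀ := by
        rw [inv_lt_comm₀ (hpos n) hτ₀, ← one_div]
        exact hlt n
      refine (UnboundedOperator.norm_cayley_sub_one_le_iff (inv_pos.2 (hpos n)) _ ?_).1
        (hV _ (inv_pos.2 (hpos n)) hτ)
      rw [inv_inv]
      exact hR n
  tfae_finish
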